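/- Let $n\ge 1$, let $\mathfrak g=\mathfrak{sp}(2n)$ be the complex symplectic Lie algebra and let $V=V_{\omega_1}=\mathbb C^{2n}$ be its natural module. The semidirect product $\mathfrak g\ltimes V$ is the Lie algebra with underlying space $\mathfrak g\oplus V$ and bracket $[x+v,x'+v']=[x,x']+x.v'-x'.v$. A Lie bialgebra structure on a Lie algebra $\mathfrak a$ is a linear map $\delta:\mathfrak a\to\mathfrak a\wedge\mathfrak a$ whose transpose is a Lie bracket on $\mathfrak a^*$ and which satisfies $\delta([a,b])=[\delta(a),b\otimes1+1\otimes b]+[a\otimes1+1\otimes a,\delta(b)]$. A Belavin–Drinfeld structure on $\mathfrak g$ is a cobracket of the form $\delta_0(x)=[r,x\otimes1+1\otimes x]$, where $r$ arises as follows. Choose a triangular decomposition $\mathfrak g=\mathfrak n_-\oplus\mathfrak h\oplus\mathfrak n_+$ with simple roots $\Delta$ and positive roots $R^+$, and a nondegenerate invariant symmetric bilinear form on $\mathfrak g$. Choose subsets $\Delta_1,\Delta_2\subset\Delta$ and a bijection $\tau:\Delta_1\to\Delta_2$ that preserves the induced form on $\mathfrak h^*$ and is such that for each $\alpha\in\Delta_1$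 there is $m>0$ with $\alpha,\tau(\alpha),\dots,\tau^{m-1}(\alpha)\in\Delta_1$ and $\tau^m(\alpha)\in\Delta_2\setminus\Delta_1$. Extend $\tau$ linearly to $\mathbb Z\Delta_1$, and choose root vectors $E_\alpha\in\mathfrak g_\alpha$, $F_\alpha\in\mathfrak g_{-\alpha}$ ($\alpha\in R^+$) with $\langle E_\alpha,F_\alpha\rangle=1$ for which $E_\alpha\mapsto E_{\tau(\alpha)}$, $F_\alpha\mapsto F_{\tau(\alpha)}$ ($\alpha\in R^+\cap\mathbb Z\Delta_1$) is induced by a Lie algebra isomorphism $\mathfrak g_{\Delta_1}\to\mathfrak g_{\Delta_2}$ of the subalgebras generated by the root spaces $\mathfrak g_{\pm\alpha}$ with $\alpha\in\Delta_1$, respectively $\alpha\in\Delta_2$. Write $\alpha<\beta$ if $\tau^m(\alpha)=\beta$ for some $m>0$. Choose $r_0\in\mathfrak h\otimes\mathfrak h$ with $r_0+r_0^{21}=c_0$, where $c_0$ is the $\mathfrak h$-part of the Casimir element of the form, and with $(\tau(\alpha)\otimes1+1\otimes\alpha)(r_0)=0$ for all $\alpha\in\Delta_1$. Then $$r=r_0+\sum_{\alpha\in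 R^+}F_\alpha\otimes E_\alpha+\sum_{\alpha,\beta\in R^+,\ \alpha<\beta}F_\alpha\wedge E_\beta,\qquad x\wedge y=x\otimes y-y\otimes x .$$ Then for every Belavin–Drinfeld structure $\delta_0$ on $\mathfrak g$, the Lie algebra $\mathfrak g\ltimes V$ admits no semidirect Lie bialgebra structure: there is no Lie bialgebra structure $\delta$ on $\mathfrak g\ltimes V$ with $\delta|_{\mathfrak g}=\delta_0$ and $\delta(V)\subset V\wedge\mathfrak g$. -/

import Mathlib

open scoped TensorProduct

noncomputable section

/-! ### Lie bialgebras -/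

section LieBialgebra

variable {L : Type*} [LieRing L] [LieAlgebra ℂ L]

/-- The bracket `[ξ, η] = (ξ ⊗ η) ∘ δ` on the dual space `L*` determined by `δ : L → L ⊗ L`. -/
def dualBracket (δ : L →ₗ[ℂ] L ⊗[ℂ] L) (ξ η : Module.Dual ℂ L) : Module.Dual ℂ L :=
  (TensorProduct.dualDistrib ℂ L L (ξ ⊗ₜ[ℂ] η)).comp δ

/-- `δ` is a Lie bialgebra structure on the Lie algebra `L`: it takes values in the
skew-symmetric tensors `L ∧ L`, its transpose is a Lie bracket on `L*`, and it satisfies the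
compatibility condition
`δ [a, b] = [δ a, b ⊗ 1 + 1 ⊗ b] + [a ⊗ 1 + 1 ⊗ a, δ b]`.
Here `⁅a, t⁆` is the (adjoint) action of `L` on `L ⊗ L`, i.e. `[a ⊗ 1 + 1 ⊗ a, t]`. -/
structure IsLieBialgebra (δ : L →ₗ[ℂ] L ⊗[ℂ] L) : Prop where
  skew : ∀ x, TensorProduct.comm ℂ L L (δ x) = -δ x
  dual_alternating : ∀ ξ, dualBracket δ ξ ξ = 0
  dual_jacobi : ∀ ξ η ζ, dualBracket δ ξ (dualBracket δ η ζ) +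
    dualBracket δ η (dualBracket δ ζ ξ) + dualBracket δ ζ (dualBracket δ ξ η) = 0
  cocycle : ∀ a b : L, δ ⁅a, b⁆ = -⁅b, δ a⁆ + ⁅a, δ b⁆

end LieBialgebra

/-! ### The semidirect product of a Lie algebra and a module -/

/-- A vector space `V` regarded as an abelian Lie algebra. -/
def AbelianLie (V : Type*) : Type _ := V

section Semidirect

variable (g V : Type*) [LieRing g] [LieAlgebra ℂ g]
  [AddCommGroup V] [Module ℂ V] [LieRingModule g V] [LieModule ℂ g V]

instance : AddCommGroup (AbelianLie V) := inferInstanceAs (AddCommGroup V)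

instance : Module ℂ (AbelianLie V) := inferInstanceAs (Module ℂ V)

instance : LieRing (AbelianLie V) where
  bracket _ _ := 0
  add_lie _ _ _ := (add_zero _).symm
  lie_add _ _ _ := (add_zero _).symm
  lie_self _ := rfl
  leibniz_lie _ _ _ := (add_zero _).symm

instance : LieAlgebra ℂ (AbelianLie V) where
  lie_smul _ _ _ := (smul_zero _).symm

/-- The action of `g` on the module `V`, as derivations of the abelian Lie algebra `V`. -/
def moduleDerivation : g →ₗ⁅ℂ⁆ LieDerivation ℂ (AbelianLie V) (AbelianLie V) where
  toFun x :=
    { toLinearMap := (LieModule.toEnd ℂ g V x : V →ₗ[ℂ] V)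
      leibniz' := fun _ _ =>
        (map_zero (LieModule.toEnd ℂ g V x)).trans (sub_zero (0 : V)).symm }
  map_add' x y := LieDerivation.ext fun v => add_lie x y (show V from v)
  map_smul' c x := LieDerivation.ext fun v => smul_lie c x (show V from v)
  map_lie' {x y} := LieDerivation.ext fun v => by
    rw [LieDerivation.commutator_apply]
    exact lie_lie x y (show V from v)

/-- The semidirect product `g ⋉ V`, with
`[x + v, x' + v'] = [x, x'] + x.v' - x'.v`. -/
abbrev InhomLie : Type _ := AbelianLie V ⋊⁅moduleDerivation g V⁆ g

/-- The inclusion `g → g ⋉ V`. -/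
def inclAlg : g →ₗ[ℂ] InhomLie g V :=
  (LieAlgebra.SemiDirectSum.inr (moduleDerivation g V) : g →ₗ[ℂ] InhomLie g V)

/-- The inclusion `V → g ⋉ V`. -/
def inclMod : V →ₗ[ℂ] InhomLie g V :=
  (LieAlgebra.SemiDirectSum.inl (moduleDerivation g V) : AbelianLie V →ₗ[ℂ] InhomLie g V)

variable {g V}

/-- `δ` is a semidirect Lie bialgebra structure on `g ⋉ V` compatible with the cobracket `δ₀`
on `g`: it is a Lie bialgebra structure, it restricts to `δ₀` on `g` (so that `(g, δ₀)` is a Lie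
subbialgebra), and it maps `V` into `V ∧ g`, the space spanned by all `v ⊗ x - x ⊗ v`. -/
structure IsSemidirectLieBialgebra (δ₀ : g →ₗ[ℂ] g ⊗[ℂ] g)
    (δ : InhomLie g V →ₗ[ℂ] InhomLie g V ⊗[ℂ] InhomLie g V) : Prop where
  isLieBialgebra : IsLieBialgebra δ
  restrict : ∀ x, δ (inclAlg g V x) = TensorProduct.map (inclAlg g V) (inclAlg g V) (δ₀ x)
  mapsTo : ∀ v, δ (inclMod g V v) ∈ Submodule.span ℂ
    {t | ∃ (w : V) (x : g), t = inclMod g V w ⊗ₜ[ℂ] inclAlg g V x -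
      inclAlg g V x ⊗ₜ[ℂ] inclMod g V w}

end Semidirect

/-! ### Belavin-Drinfeld structures -/

section BelavinDrinfeld

variable {L : Type*} [LieRing L] [LieAlgebra ℂ L]

/-- The root space `{x | [h, x] = α(h) x for all h ∈ H}`. -/
abbrev rootSpaceOf (H : LieSubalgebra ℂ L) [LieRing.IsNilpotent H] (α : Module.Dual ℂ H) :
    LieSubmodule ℂ H L :=
  LieModule.weightSpace L α

/-- `α` is a root of `L` with respect to `H`. -/
def IsRootOf (H : LieSubalgebra ℂ L) [LieRing.IsNilpotent H] (α : Module.Dual ℂ H) : Prop :=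
  α ≠ 0 ∧ rootSpaceOf H α ≠ ⊥

/-- The subalgebra generated by the root spaces of `α` and `-α` for `α ∈ S`. When `S` is a set of
simple roots this is the semisimple part of the Levi subalgebra given by `S`. -/
def leviSemisimple (H : LieSubalgebra ℂ L) [LieRing.IsNilpotent H]
    (S : Set (Module.Dual ℂ H)) : LieSubalgebra ℂ L :=
  LieSubalgebra.lieSpan ℂ L {x | ∃ α ∈ S, x ∈ rootSpaceOf H α ∨ x ∈ rootSpaceOf H (-α)}

/-- `t` is the canonical (Casimir) element `∑ eᵢ ⊗ eⁱ` of the bilinear form `B`, where `(eᵢ)` and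
`(eⁱ)` are dual bases: contracting its first factor with `x` gives `x`. -/
def IsCanonicalElement {M : Type*} [AddCommGroup M] [Module ℂ M] (B : LinearMap.BilinForm ℂ M)
    (t : M ⊗[ℂ] M) : Prop :=
  ∀ x, TensorProduct.lid ℂ M (TensorProduct.map (B x) LinearMap.id t) = x

/-- A triangular decomposition of `L` with Cartan subalgebra `H` (given by a base `simple` of the
root system, with set of positive roots `pos`), an invariant form on `L`, and dual root
vectors. -/
structure TriangularDatum (H : LieSubalgebra ℂ L) [H.IsCartanSubalgebra] where
  /-- the invariant form on `L` -/
  form : LinearMap.BilinForm ℂ L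
  form_symm : ∀ x y, form x y = form y x
  form_nondeg : form.Nondegenerate
  form_invariant : ∀ x y z, form ⁅x, y⁆ z = form x ⁅y, z⁆
  /-- the set of simple roots -/
  simple : Set (Module.Dual ℂ H)
  isRoot_of_simple : ∀ α ∈ simple, IsRootOf H α
  linearIndependent : LinearIndepOn ℂ id simple
  pos_or_neg : ∀ α, IsRootOf H α →
    α ∈ AddSubmonoid.closure simple ∨ -α ∈ AddSubmonoid.closure simple
  /-- the set of positive roots -/
  pos : Finset (Module.Dual ℂ H)
  mem_pos : ∀ α, α ∈ pos ↔ IsRootOf H α ∧ α ∈ AddSubmonoid.closure simple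
  /-- the identification of `H*` with `H` by means of the form -/
  dualVec : Module.Dual ℂ H → H
  form_dualVec : ∀ α (h : H), form (dualVec α) h = α h
  /-- root vectors for the positive roots -/
  E : Module.Dual ℂ H → L
  /-- root vectors for the negative roots -/
  F : Module.Dual ℂ H → L
  E_mem : ∀ α ∈ pos, E α ∈ rootSpaceOf H α
  F_mem : ∀ α ∈ pos, F α ∈ rootSpaceOf H (-α)
  form_E_F : ∀ α ∈ pos, form (E α) (F α) = 1

/-- A Belavin-Drinfeld triple `(Δ₁, Δ₂, τ)`, an isomorphism `θ` of the corresponding semisimple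
subalgebras which matches the chosen root vectors, and an element `r₀ ∈ H ⊗ H` as required in the
Belavin-Drinfeld classification. The map `τ` is the linear extension of the bijection `Δ₁ → Δ₂`;
only its values on `ℤΔ₁` are used. -/
structure BelavinDrinfeldDatum (H : LieSubalgebra ℂ L) [H.IsCartanSubalgebra] extends
    TriangularDatum H where
  /-- the subset `Δ₁` -/
  Δ₁ : Set (Module.Dual ℂ H)
  /-- the subset `Δ₂` -/
  Δ₂ : Set (Module.Dual ℂ H)
  Δ₁_subset : Δ₁ ⊆ simple
  Δ₂_subset : Δ₂ ⊆ simple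
  /-- the map `τ` -/
  τ : Module.Dual ℂ H →ₗ[ℂ] Module.Dual ℂ H
  bijOn : Set.BijOn τ Δ₁ Δ₂
  isometry : ∀ α ∈ Δ₁, ∀ β ∈ Δ₁,
    form (dualVec (τ α)) (dualVec (τ β)) = form (dualVec α) (dualVec β)
  nilpotent : ∀ α ∈ Δ₁, ∃ n > 0, (∀ k < n, τ^[k] α ∈ Δ₁) ∧ τ^[n] α ∈ Δ₂ \ Δ₁
  /-- the isomorphism of semisimple subalgebras induced by `τ` -/
  θ : leviSemisimple H Δ₁ ≃ₗ⁅ℂ⁆ leviSemisimple H Δ₂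
  θ_E : ∀ α ∈ pos, α ∈ AddSubgroup.closure Δ₁ →
    ∀ x : leviSemisimple H Δ₁, (x : L) = E α → (θ x : L) = E (τ α)
  θ_F : ∀ α ∈ pos, α ∈ AddSubgroup.closure Δ₁ →
    ∀ x : leviSemisimple H Δ₁, (x : L) = F α → (θ x : L) = F (τ α)
  /-- the Cartan part of the `r`-matrix -/
  r₀ : H ⊗[ℂ] H
  r₀_symm : IsCanonicalElement (form.restrict H.toSubmodule) (r₀ + TensorProduct.comm ℂ H H r₀)
  r₀_τ : ∀ α ∈ Δ₁, TensorProduct.lid ℂ H (TensorProduct.map (τ α) LinearMap.id r₀) +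
    TensorProduct.rid ℂ H (TensorProduct.map LinearMap.id α r₀) = 0

namespace BelavinDrinfeldDatum

variable {H : LieSubalgebra ℂ L} [H.IsCartanSubalgebra] (D : BelavinDrinfeldDatum H)

/-- The partial order on positive roots: `α < β` if `β = τⁿ(α)` for some `n > 0`, where all of
`α, τ(α), …, τⁿ⁻¹(α)` are positive roots in `ℤΔ₁`. -/
def rootLT : Module.Dual ℂ H → Module.Dual ℂ H → Prop :=
  Relation.TransGen fun α β => α ∈ D.pos ∧ α ∈ AddSubgroup.closure D.Δ₁ ∧ D.τ α = β

open Classical in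
/-- The `r`-matrix
`r = r₀ + ∑_{α > 0} F_α ⊗ E_α + ∑_{α < β} F_α ∧ E_β`, where `x ∧ y = x ⊗ y - y ⊗ x`. -/
def rMatrix : L ⊗[ℂ] L :=
  TensorProduct.map H.toSubmodule.subtype H.toSubmodule.subtype D.r₀ +
    ∑ α ∈ D.pos, D.F α ⊗ₜ[ℂ] D.E α +
    ∑ p ∈ (D.pos ×ˢ D.pos).filter (fun p => D.rootLT p.1 p.2),
      (D.F p.1 ⊗ₜ[ℂ] D.E p.2 - D.E p.2 ⊗ₜ[ℂ] D.F p.1)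

end BelavinDrinfeldDatum

/-- `δ` is a Belavin-Drinfeld Lie bialgebra structure on `L`:
`δ x = [r, x ⊗ 1 + 1 ⊗ x]` for the `r`-matrix `r` of some Belavin-Drinfeld triple, with respect to
some triangular decomposition of `L`. -/
def IsBelavinDrinfeld (δ : L →ₗ[ℂ] L ⊗[ℂ] L) : Prop :=
  ∃ (H : LieSubalgebra ℂ L) (_ : H.IsCartanSubalgebra) (D : BelavinDrinfeldDatum H),
    ∀ x : L, δ x = -⁅x, D.rMatrix⁆

end BelavinDrinfeld

/-! ### The natural module of the symplectic Lie algebra -/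

section Natural

attribute [local instance 100] LieRing.ofAssociativeRing

/-- The Lie algebra `sp(2n)` of complex `2n × 2n` matrices. -/
abbrev SpLie (n : ℕ) : LieSubalgebra ℂ (Matrix (Fin n ⊕ Fin n) (Fin n ⊕ Fin n) ℂ) :=
  LieAlgebra.Symplectic.sp (Fin n) ℂ

/-- The natural module `V_{ω₁} = ℂ²ⁿ` of `sp(2n)`: column vectors, on which matrices act by
multiplication. -/
def NaturalModule (n : ℕ) : Type := Fin n ⊕ Fin n → ℂ

namespace NaturalModule

variable (n : ℕ)

instance : AddCommGroup (NaturalModule n) := inferInstanceAs (AddCommGroup (Fin n ⊕ Fin n → ℂ))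

instance : Module ℂ (NaturalModule n) := inferInstanceAs (Module ℂ (Fin n ⊕ Fin n → ℂ))

instance : LieRingModule (SpLie n) (NaturalModule n) where
  bracket A v := Matrix.mulVec A.1 v
  add_lie A B v := Matrix.add_mulVec A.1 B.1 v
  lie_add A v w := Matrix.mulVec_add A.1 v w
  leibniz_lie A B v := by
    have h (M N : Matrix (Fin n ⊕ Fin n) (Fin n ⊕ Fin n) ℂ) (w : Fin n ⊕ Fin n → ℂ) :
        M.mulVec (N.mulVec w) = (M * N - N * M).mulVec w + N.mulVec (M.mulVec w) := by
      rw [Matrix.sub_mulVec, Matrix.mulVec_mulVec, Matrix.mulVec_mulVec, sub_add_cancel]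
    exact h A.1 B.1 v

instance : LieModule ℂ (SpLie n) (NaturalModule n) where
  smul_lie c A v := Matrix.smul_mulVec c A.1 v
  lie_smul c A v := Matrix.mulVec_smul A.1 c v

end NaturalModule

end Natural

end

/-! Put `s = (r - r²¹)/2`. Since `δ₀` is skew, `δ₀ x = -x.s` (`eq_neg_lie_skewPart`). A semidirect
cobracket `δ` is determined on `V` by its component `mixedPart δ : V → g ⊗ V`. The cocycle condition
for a pair in `g × V` is an inhomogeneous linear equation for this map, and `v ↦ (1 ⊗ ·.v)(s)` is
one solution. The two therefore differ by an equivariant map `F : V → g ⊗ V`.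

Via the trace form, `F` becomes an equivariant map `g → End V`. Such a map is a scalar `c` times the
action (`exists_eq_smul_lie`), because its value at the highest root vector is forced by weights.
The cocycle condition on `V × V`, where the bracket vanishes, then gives `c = 0`
(`contractFirst_eq_zero`). Hence the mixed part is exactly the one given by `s`.

The Jacobi identity in the dual for two elements of `g*` and one of `V*`, with faithfulness of `V`,
now says that contraction with `s` is an anti-homomorphism `g* → g` (`lie_contractFirst_lie`), which
is the classical Yang–Baxter equation for `s`. But a Belavin–Drinfeld `s` fails it
(`not_antihomomorphism`). By nilpotency of `τ` there is a simple root `γ` outside `ℤΔ₁`; contraction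
sends `⟨E_γ, ·⟩` to `E_γ/2`, and testing the identity on `E_γ`, `F_γ` and `h` in the Cartan
subalgebra yields `γ(h) = 0` for all `h`. -/

noncomputable section

/-! ### Contraction of tensors with functionals -/

section Contraction

variable {M N : Type*} [AddCommGroup M] [Module ℂ M] [AddCommGroup N] [Module ℂ N]

/-- Contraction of the first tensor factor with a functional. -/
def contractFirst (N : Type*) [AddCommGroup N] [Module ℂ N] (ξ : Module.Dual ℂ M) :
    M ⊗[ℂ] N →ₗ[ℂ] N :=
  (TensorProduct.lid ℂ N).toLinearMap ∘ₗ TensorProduct.map ξ LinearMap.id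

@[simp]
theorem contractFirst_tmul (ξ : Module.Dual ℂ M) (m : M) (n : N) :
    contractFirst N ξ (m ⊗ₜ[ℂ] n) = ξ m • n := by
  simp [contractFirst]

theorem dualDistrib_eq_contractFirst (ξ : Module.Dual ℂ M) (η : Module.Dual ℂ N) (t : M ⊗[ℂ] N) :
    TensorProduct.dualDistrib ℂ M N (ξ ⊗ₜ[ℂ] η) t = η (contractFirst N ξ t) := by
  induction t with
  | zero => simp
  | tmul x y => simp
  | add x y hx hy => simp only [map_add, hx, hy]

theorem dualDistrib_comm (ξ : Module.Dual ℂ M) (η : Module.Dual ℂ N) (t : N ⊗[ℂ] M) :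
    TensorProduct.dualDistrib ℂ M N (ξ ⊗ₜ[ℂ] η) (TensorProduct.comm ℂ N M t) =
      TensorProduct.dualDistrib ℂ N M (η ⊗ₜ[ℂ] ξ) t := by
  induction t with
  | zero => simp
  | tmul x y => simp [mul_comm]
  | add x y hx hy => simp only [map_add, hx, hy]

end Contraction

/-! ### The cone of positive combinations is pointed -/

section RootCone

/-- In the cone spanned by a linearly independent set, only zero has its negative in the cone. -/
theorem eq_zero_of_mem_closure_of_neg_mem_closure {W : Type*} [AddCommGroup W] [Module ℂ W]
    {S : Set W} (hS : LinearIndepOn ℂ id S) {a : W} (ha : a ∈ AddSubmonoid.closure S)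
    (hna : -a ∈ AddSubmonoid.closure S) : a = 0 := by
  -- The height function: a natural number on the cone, vanishing there only at `0`.
  obtain ⟨f, hf⟩ : ∃ f : W →ₗ[ℂ] ℂ, ∀ s ∈ S, f s = 1 := by
    have hS' : LinearIndependent ℂ fun x : S => (x : W) := hS
    obtain ⟨f, hf⟩ := LinearMap.exists_extend ((Module.Basis.span hS').constr ℂ fun _ => (1 : ℂ))
    refine ⟨f, fun s hs => ?_⟩
    have h1 := LinearMap.congr_fun hf (Module.Basis.span hS' ⟨s, hs⟩)
    rw [Module.Basis.constr_basis] at h1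
    rw [LinearMap.comp_apply, Submodule.subtype_apply, Module.Basis.span_apply] at h1
    exact h1
  have key : ∀ x ∈ AddSubmonoid.closure S, ∃ k : ℕ, f x = k ∧ (k = 0 → x = 0) := by
    intro x hx
    induction hx using AddSubmonoid.closure_induction with
    | mem x hx => exact ⟨1, by simp [hf x hx], by simp⟩
    | zero => exact ⟨0, by simp, fun _ => rfl⟩
    | add x y _ _ hx hy =>
      obtain ⟨k, hk, hk0⟩ := hx
      obtain ⟨l, hl, hl0⟩ := hy
      refine ⟨k + l, by simp [hk, hl], fun h => ?_⟩
      rw [hk0 (by omega), hl0 (by omega), add_zero]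
  obtain ⟨k, hk, hk0⟩ := key a ha
  obtain ⟨l, hl, -⟩ := key (-a) hna
  apply hk0
  rw [map_neg, hk] at hl
  have : ((k + l : ℕ) : ℂ) = 0 := by push_cast; rw [← hl]; ring
  have := Nat.cast_eq_zero.mp this
  omega

end RootCone

/-! ### Invariant form and root spaces -/

section BelavinDrinfeld

variable {L : Type*} [LieRing L] [LieAlgebra ℂ L] {H : LieSubalgebra ℂ L} [H.IsCartanSubalgebra]

theorem lie_of_mem_rootSpaceOf {α : Module.Dual ℂ H} {x : L} (hx : x ∈ rootSpaceOf H α) (h : H) :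
    ⁅(h : L), x⁆ = α h • x :=
  (LieModule.mem_weightSpace (⇑α) x).mp hx h

namespace TriangularDatum

variable (D : TriangularDatum H)

theorem form_eq_zero_of_add_ne_zero {α β : Module.Dual ℂ H} {x y : L} (hx : x ∈ rootSpaceOf H α)
    (hy : y ∈ rootSpaceOf H β) (h : α + β ≠ 0) : D.form x y = 0 := by
  obtain ⟨z, hz⟩ : ∃ z, (α + β) z ≠ 0 := by
    by_contra! hc
    exact h (LinearMap.ext hc)
  have h1 := D.form_invariant x z y
  rw [← lie_skew, lie_of_mem_rootSpaceOf hx, lie_of_mem_rootSpaceOf hy] at h1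
  simp only [map_neg, LinearMap.neg_apply, map_smul, LinearMap.smul_apply, smul_eq_mul] at h1
  have : (α + β) z * D.form x y = 0 := by
    rw [LinearMap.add_apply]; linear_combination -h1
  exact (mul_eq_zero.mp this).resolve_left hz

/-- The Cartan subalgebra is only known to be nilpotent, so `ad w` need not kill `z`. By invariance,
moving `ad w` across the form multiplies by `-α(w)`, and a power of `ad w` vanishes on `H`. -/
theorem form_eq_zero_of_mem_cartan {α : Module.Dual ℂ H} {x : L} (hx : x ∈ rootSpaceOf H α)
    (h : α ≠ 0) (z : H) : D.form x z = 0 := by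
  obtain ⟨w, hw⟩ : ∃ w, α w ≠ 0 := by
    by_contra! hc
    exact h (LinearMap.ext hc)
  obtain ⟨k, hk⟩ := LieModule.exists_forall_pow_toEnd_eq_zero ℂ H H
  have key : ∀ m : ℕ, ∀ z : H,
      D.form x ((LieModule.toEnd ℂ H H w ^ m) z : H) = (-α w) ^ m * D.form x z := by
    intro m
    induction m with
    | zero => simp
    | succ m ih =>
      intro z
      rw [pow_succ, Module.End.mul_apply, ih, LieModule.toEnd_apply_apply, LieSubalgebra.coe_bracket,
        ← D.form_invariant, ← lie_skew, lie_of_mem_rootSpaceOf hx]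
      simp only [map_neg, LinearMap.neg_apply, map_smul, LinearMap.smul_apply, smul_eq_mul]
      ring
  have h1 := key k z
  rw [hk w] at h1
  simp only [LinearMap.zero_apply, ZeroMemClass.coe_zero, map_zero] at h1
  exact (mul_eq_zero.mp h1.symm).resolve_left (pow_ne_zero _ (neg_ne_zero.mpr hw))

/-- Without simple roots there are no roots, so `L` equals the nilpotent algebra `H`; but `ad x` has
the nonzero eigenvalue `2`. -/
theorem simple_nonempty [FiniteDimensional ℂ L] {x y : L} (hy : y ≠ 0)
    (hxy : ⁅x, y⁆ = (2 : ℂ) • y) : D.simple.Nonempty := by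
  by_contra hne
  rw [Set.not_nonempty_iff_eq_empty] at hne
  have hweight : ∀ χ : LieModule.Weight ℂ H L, (χ : H → ℂ) = 0 := by
    intro χ
    by_contra hχ
    -- A generalized weight space contains a true simultaneous eigenvector, so a nonzero weight is a
    -- root in the sense of `IsRootOf`.
    obtain ⟨m, hm₀, hm⟩ := LieModule.exists_forall_lie_eq_smul ℂ H L χ
    have hroot : IsRootOf H (LieModule.Weight.toLinear ℂ H L χ) := by
      refine ⟨fun h => hχ (funext fun z => LinearMap.congr_fun h z), fun h => hm₀ ?_⟩
      have : m ∈ rootSpaceOf H (LieModule.Weight.toLinear ℂ H L χ) :=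
        (LieModule.mem_weightSpace _ m).mpr hm
      rwa [h, LieSubmodule.mem_bot] at this
    have h1 := D.pos_or_neg _ hroot
    rw [hne, AddSubmonoid.closure_empty, AddSubmonoid.mem_bot, AddSubmonoid.mem_bot,
      neg_eq_zero, or_self] at h1
    exact hroot.1 h1
  have htop : ∀ a : L, a ∈ H := by
    intro a
    have h1 : (⊤ : LieSubmodule ℂ H L) ≤ LieAlgebra.rootSpace H 0 := by
      rw [← LieModule.iSup_genWeightSpace_eq_top' ℂ H L]
      exact iSup_le fun χ => by rw [hweight χ]
    have h2 : a ∈ LieAlgebra.zeroRootSubalgebra ℂ L H := h1 (LieSubmodule.mem_top a)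
    rwa [LieAlgebra.zeroRootSubalgebra_eq_of_is_cartan] at h2
  obtain ⟨k, hk⟩ := LieModule.exists_forall_pow_toEnd_eq_zero ℂ H H
  have key : ∀ m : ℕ, ((LieModule.toEnd ℂ H H ⟨x, htop x⟩ ^ m) ⟨y, htop y⟩ : H) =
      (2 : ℂ) ^ m • ⟨y, htop y⟩ := by
    intro m
    induction m with
    | zero => simp
    | succ m ih =>
      rw [pow_succ', Module.End.mul_apply, ih, map_smul, LieModule.toEnd_apply_apply, pow_succ,
        mul_smul]
      congr 1
      exact Subtype.ext hxy
  have h1 := key k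
  rw [hk, LinearMap.zero_apply, eq_comm, smul_eq_zero] at h1
  exact h1.elim (pow_ne_zero _ two_ne_zero) fun h => hy (congrArg Subtype.val h)

theorem form_E_E {α β : Module.Dual ℂ H} (hα : α ∈ D.pos) (hβ : β ∈ D.pos) :
    D.form (D.E α) (D.E β) = 0 := by
  have h1 := (D.mem_pos α).mp hα
  refine D.form_eq_zero_of_add_ne_zero (D.E_mem α hα) (D.E_mem β hβ) fun h => h1.1.1 ?_
  refine eq_zero_of_mem_closure_of_neg_mem_closure D.linearIndependent h1.2 ?_
  rw [neg_eq_of_add_eq_zero_right h]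
  exact ((D.mem_pos β).mp hβ).2

theorem form_E_F_of_ne {α β : Module.Dual ℂ H} (hα : α ∈ D.pos) (hβ : β ∈ D.pos) (h : α ≠ β) :
    D.form (D.E α) (D.F β) = 0 :=
  D.form_eq_zero_of_add_ne_zero (D.E_mem α hα) (D.F_mem β hβ) (by rwa [← sub_eq_add_neg, sub_ne_zero])

theorem form_cartan_E {α : Module.Dual ℂ H} (hα : α ∈ D.pos) (h : H) : D.form h (D.E α) = 0 := by
  rw [D.form_symm]
  exact D.form_eq_zero_of_mem_cartan (D.E_mem α hα) ((D.mem_pos α).mp hα).1.1 h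

theorem form_cartan_F {α : Module.Dual ℂ H} (hα : α ∈ D.pos) (h : H) : D.form h (D.F α) = 0 := by
  rw [D.form_symm]
  exact D.form_eq_zero_of_mem_cartan (D.F_mem α hα)
    (neg_ne_zero.mpr ((D.mem_pos α).mp hα).1.1) h

end TriangularDatum

/-! ### The skew part of a Belavin–Drinfeld matrix -/

namespace BelavinDrinfeldDatum

variable (D : BelavinDrinfeldDatum H)

/-- Nilpotency of `τ` pushes any root of `Δ₁` out of `Δ₁` within the simple roots; linear
independence then keeps the resulting root out of `ℤΔ₁`. -/
theorem exists_simple_notMem_closure (hne : D.simple.Nonempty) :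
    ∃ γ ∈ D.simple, γ ∉ AddSubgroup.closure D.Δ₁ := by
  obtain ⟨γ, hγ, hγ₁⟩ : ∃ γ ∈ D.simple, γ ∉ D.Δ₁ := by
    obtain ⟨α, hα⟩ := hne
    by_cases hα₁ : α ∈ D.Δ₁
    · obtain ⟨k, -, -, hk⟩ := D.nilpotent α hα₁
      exact ⟨_, D.Δ₂_subset hk.1, hk.2⟩
    · exact ⟨α, hα, hα₁⟩
  refine ⟨γ, hγ, fun h => ?_⟩
  have hle : AddSubgroup.closure D.Δ₁ ≤ (Submodule.span ℂ D.Δ₁).toAddSubgroup :=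
    (AddSubgroup.closure_le _).mpr Submodule.subset_span
  have hins : LinearIndepOn ℂ id (insert γ D.Δ₁) :=
    D.linearIndependent.mono (Set.insert_subset hγ D.Δ₁_subset)
  exact (linearIndepOn_insert hγ₁).mp hins |>.2 (by simpa using hle h)

theorem mem_closure_of_rootLT {α β : Module.Dual ℂ H} (h : D.rootLT α β) :
    α ∈ AddSubgroup.closure D.Δ₁ := by
  induction h using Relation.TransGen.head_induction_on with
  | single h => exact h.2.1
  | head h _ _ => exact h.2.1

/-- The skew-symmetric tensor `r - r²¹`, twice the skew-symmetric part of the `r`-matrix. -/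
def skewMatrix : L ⊗[ℂ] L :=
  D.rMatrix - TensorProduct.comm ℂ L L D.rMatrix

omit [H.IsCartanSubalgebra] in
theorem contractFirst_map_cartan (ξ : Module.Dual ℂ L) (t : H ⊗[ℂ] H) :
    contractFirst L ξ (TensorProduct.map H.toSubmodule.subtype H.toSubmodule.subtype t) =
      contractFirst H (ξ ∘ₗ H.toSubmodule.subtype) t := by
  induction t with
  | zero => simp
  | tmul x y => simp
  | add x y hx hy => simp only [map_add, hx, hy, H.coe_add]

open Classical in
theorem skewMatrix_eq : D.skewMatrix =
    TensorProduct.map H.toSubmodule.subtype H.toSubmodule.subtype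
      (D.r₀ - TensorProduct.comm ℂ H H D.r₀) +
    ∑ α ∈ D.pos, (D.F α ⊗ₜ[ℂ] D.E α - D.E α ⊗ₜ[ℂ] D.F α) +
    (2 : ℂ) • ∑ p ∈ (D.pos ×ˢ D.pos).filter (fun p => D.rootLT p.1 p.2),
      (D.F p.1 ⊗ₜ[ℂ] D.E p.2 - D.E p.2 ⊗ₜ[ℂ] D.F p.1) := by
  rw [skewMatrix, rMatrix]
  simp only [map_add, map_sum, map_sub, TensorProduct.comm_tmul, Finset.sum_sub_distrib,
    ← TensorProduct.map_comm]
  module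

/-- Only `F_γ` pairs nontrivially with `E_γ`. In the terms `F_α ∧ E_β` with `α < β` the root `α`
lies in `ℤΔ₁`, so `F_γ` never occurs there and only `F_γ ⊗ E_γ` survives. -/
theorem contractFirst_E_skewMatrix {γ : Module.Dual ℂ H} (hγ : γ ∈ D.pos)
    (hγ₁ : γ ∉ AddSubgroup.closure D.Δ₁) :
    contractFirst L (D.form (D.E γ)) D.skewMatrix = D.E γ := by
  classical
  rw [skewMatrix_eq, map_add, map_add, contractFirst_map_cartan, map_smul, map_sum, map_sum]
  have h0 : D.form (D.E γ) ∘ₗ H.toSubmodule.subtype = 0 := by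
    ext h
    exact D.form_eq_zero_of_mem_cartan (D.E_mem γ hγ) ((D.mem_pos γ).mp hγ).1.1 h
  rw [Finset.sum_eq_single_of_mem γ hγ, Finset.sum_eq_zero, h0]
  · simp [contractFirst, D.form_E_F γ hγ, D.form_E_E hγ hγ]
  · intro p hp
    simp only [Finset.mem_filter, Finset.mem_product] at hp
    have hne : γ ≠ p.1 := by
      rintro rfl
      exact hγ₁ (D.mem_closure_of_rootLT hp.2)
    simp [D.form_E_F_of_ne hγ hp.1.1 hne, D.form_E_E hγ hp.1.2]
  · intro β hβ hne
    simp [D.form_E_F_of_ne hγ hβ hne.symm, D.form_E_E hγ hβ]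

theorem contractFirst_cartan_skewMatrix (h : H) :
    contractFirst L (D.form h) D.skewMatrix ∈ H := by
  classical
  rw [skewMatrix_eq, map_add, map_add, contractFirst_map_cartan, map_smul, map_sum, map_sum]
  rw [Finset.sum_eq_zero, Finset.sum_eq_zero]
  · simp only [smul_zero, add_zero, SetLike.coe_mem]
  · intro p hp
    simp only [Finset.mem_filter, Finset.mem_product] at hp
    simp [D.form_cartan_F hp.1.1, D.form_cartan_E hp.1.2]
  · intro β hβ
    simp [D.form_cartan_F hβ, D.form_cartan_E hβ]

theorem comm_skewMatrix : TensorProduct.comm ℂ L L D.skewMatrix = -D.skewMatrix := by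
  simp [skewMatrix, TensorProduct.comm_comm]

theorem dualDistrib_lie {ξ η ξ' η' : Module.Dual ℂ L} (x : L) (hξ : ∀ a, ξ ⁅x, a⁆ = ξ' a)
    (hη : ∀ a, η ⁅x, a⁆ = η' a) (t : L ⊗[ℂ] L) :
    TensorProduct.dualDistrib ℂ L L (ξ ⊗ₜ[ℂ] η) ⁅x, t⁆ =
      TensorProduct.dualDistrib ℂ L L (ξ' ⊗ₜ[ℂ] η) t +
      TensorProduct.dualDistrib ℂ L L (ξ ⊗ₜ[ℂ] η') t := by
  induction t with
  | zero => simp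
  | tmul a b => simp [TensorProduct.LieModule.lie_tmul_right, hξ, hη]
  | add a b ha hb => rw [lie_add, map_add, ha, hb, map_add, map_add]; abel

/-- Half the skew-symmetric part of a Belavin-Drinfeld matrix does not satisfy the classical
Yang-Baxter equation, in the form that contraction is an anti-homomorphism from the dual. -/
theorem not_antihomomorphism (hne : D.simple.Nonempty)
    (hhom : ∀ ξ η ν : Module.Dual ℂ L,
      (∀ x, ν x = -TensorProduct.dualDistrib ℂ L L (ξ ⊗ₜ[ℂ] η) ⁅x, (1 / 2 : ℂ) • D.skewMatrix⁆) →
      ⁅contractFirst L η ((1 / 2 : ℂ) • D.skewMatrix),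
        contractFirst L ξ ((1 / 2 : ℂ) • D.skewMatrix)⁆ =
      contractFirst L ν ((1 / 2 : ℂ) • D.skewMatrix)) : False := by
  obtain ⟨γ, hγs, hγ₁⟩ := D.exists_simple_notMem_closure hne
  have hγ : γ ∈ D.pos :=
    (D.mem_pos γ).mpr ⟨D.isRoot_of_simple γ hγs, AddSubmonoid.subset_closure hγs⟩
  obtain ⟨h, hh⟩ : ∃ h, γ h ≠ 0 := by
    by_contra! hc
    exact ((D.mem_pos γ).mp hγ).1.1 (LinearMap.ext hc)
  obtain ⟨s, hs⟩ : ∃ s : L ⊗[ℂ] L, s = (1 / 2 : ℂ) • D.skewMatrix := ⟨_, rfl⟩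
  rw [← hs] at hhom
  have hskew : TensorProduct.comm ℂ L L s = -s := by
    rw [hs, map_smul, comm_skewMatrix, smul_neg]
  set ξ : Module.Dual ℂ L := D.form (D.E γ) with hξ
  set η : Module.Dual ℂ L := D.form (D.F γ) with hη
  -- The bracket of `ξ` and `η` in the dual Lie algebra.
  let ν : Module.Dual ℂ L :=
    { toFun x := -TensorProduct.dualDistrib ℂ L L (ξ ⊗ₜ[ℂ] η) ⁅x, s⁆
      map_add' x y := by rw [add_lie, map_add, neg_add]
      map_smul' c x := by rw [smul_lie, map_smul, smul_neg]; rfl }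
  have hρξ : contractFirst L ξ s = (1 / 2 : ℂ) • D.E γ := by
    rw [hs, map_smul, D.contractFirst_E_skewMatrix hγ hγ₁]
  -- Under `H` the functionals `ξ` and `η` have opposite weights, which cancel.
  have hν : ∀ z : H, ν z = 0 := by
    intro z
    change -TensorProduct.dualDistrib ℂ L L (ξ ⊗ₜ[ℂ] η) ⁅(z : L), s⁆ = 0
    rw [dualDistrib_lie (ξ' := (-γ z) • ξ) (η' := γ z • η), TensorProduct.smul_tmul,
      TensorProduct.tmul_smul, TensorProduct.tmul_smul, map_smul, map_smul]
    · simp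
    · intro a
      rw [hξ, ← D.form_invariant, ← lie_skew, lie_of_mem_rootSpaceOf (D.E_mem γ hγ)]
      simp
    · intro a
      rw [hη, ← D.form_invariant, ← lie_skew, lie_of_mem_rootSpaceOf (D.F_mem γ hγ)]
      simp
  have hswap : ∀ φ ψ : Module.Dual ℂ L, ψ (contractFirst L φ s) = -φ (contractFirst L ψ s) := by
    intro φ ψ
    rw [← dualDistrib_eq_contractFirst, ← dualDistrib_eq_contractFirst, ← dualDistrib_comm, hskew,
      map_neg]
  -- The right side becomes `-ν` at an element of `H`, hence `0`; the left side becomes `γ(h)/4` by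
  -- invariance and skewness of `s`.
  have h1 := congrArg (D.form h) (hhom ξ η ν fun x => rfl)
  rw [hswap ν] at h1
  have h2 : contractFirst L (D.form h) s ∈ H := by
    rw [hs, map_smul]
    exact H.smul_mem _ (D.contractFirst_cartan_skewMatrix h)
  rw [show ν (contractFirst L (D.form h) s) = 0 from hν ⟨_, h2⟩, hρξ, D.form_symm,
    D.form_invariant, ← lie_skew, lie_smul, lie_of_mem_rootSpaceOf (D.E_mem γ hγ), D.form_symm] at h1
  simp only [map_neg, map_smul, LinearMap.neg_apply, LinearMap.smul_apply, smul_eq_mul] at h1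
  rw [← hξ, hswap η ξ, hρξ, hη, map_smul, D.form_symm, D.form_E_F γ hγ] at h1
  simp at h1
  exact hh h1

end BelavinDrinfeldDatum

end BelavinDrinfeld

/-! ### Semidirect cobrackets and their mixed part -/

section SemidirectBialgebra

variable {g V : Type*} [LieRing g] [LieAlgebra ℂ g]
  [AddCommGroup V] [Module ℂ V] [LieRingModule g V] [LieModule ℂ g V]

variable (g V) in
/-- The projection `g ⋉ V → g`. -/
def projAlg : InhomLie g V →ₗ[ℂ] g :=
  (LieAlgebra.SemiDirectSum.projr (moduleDerivation g V) : InhomLie g V →ₗ[ℂ] g)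

variable (g V) in
/-- The projection `g ⋉ V → V`. -/
def projMod : InhomLie g V →ₗ[ℂ] V :=
  (LieAlgebra.SemiDirectSum.projl (moduleDerivation g V) : InhomLie g V →ₗ[ℂ] AbelianLie V)

@[simp] theorem projAlg_inclAlg (x : g) : projAlg g V (inclAlg g V x) = x := rfl
@[simp] theorem projAlg_inclMod (v : V) : projAlg g V (inclMod g V v) = 0 := rfl
@[simp] theorem projMod_inclAlg (x : g) : projMod g V (inclAlg g V x) = 0 := rfl
@[simp] theorem projMod_inclMod (v : V) : projMod g V (inclMod g V v) = v := rfl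

theorem inclMod_projMod_add_inclAlg_projAlg (a : InhomLie g V) :
    inclMod g V (projMod g V a) + inclAlg g V (projAlg g V a) = a :=
  LieAlgebra.SemiDirectSum.ext (add_zero _) (zero_add _)

theorem lie_inclAlg_inclAlg (x y : g) :
    ⁅inclAlg g V x, inclAlg g V y⁆ = inclAlg g V ⁅x, y⁆ :=
  ((LieAlgebra.SemiDirectSum.inr (moduleDerivation g V)).map_lie x y).symm

theorem lie_inclAlg_inclMod (x : g) (v : V) :
    ⁅inclAlg g V x, inclMod g V v⁆ = inclMod g V ⁅x, v⁆ := by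
  refine LieAlgebra.SemiDirectSum.ext ?_ (lie_zero x)
  change (0 : V) + ⁅x, v⁆ - ⁅(0 : g), (0 : V)⁆ = ⁅x, v⁆
  simp

theorem lie_inclMod_inclAlg (v : V) (x : g) :
    ⁅inclMod g V v, inclAlg g V x⁆ = -inclMod g V ⁅x, v⁆ := by
  rw [← lie_skew, lie_inclAlg_inclMod]

theorem lie_inclMod_inclMod (v w : V) : ⁅inclMod g V v, inclMod g V w⁆ = 0 := by
  refine LieAlgebra.SemiDirectSum.ext ?_ (lie_zero 0)
  change (0 : V) + ⁅(0 : g), w⁆ - ⁅(0 : g), v⁆ = 0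
  simp

variable (g) in
/-- The orbit map `x ↦ x.v`. -/
def orbitMap (v : V) : g →ₗ[ℂ] V :=
  (LieModule.toEnd ℂ g V : g →ₗ[ℂ] Module.End ℂ V).flip v

@[simp] theorem orbitMap_add (v w : V) : orbitMap g (v + w) = orbitMap g v + orbitMap g w :=
  map_add _ _ _

@[simp] theorem orbitMap_smul (c : ℂ) (v : V) : orbitMap g (c • v) = c • orbitMap g v :=
  map_smul _ _ _

/-- The map `a ⊗ b ↦ a ⊗ b.v`. -/
def actSecond (v : V) : g ⊗[ℂ] g →ₗ[ℂ] g ⊗[ℂ] V :=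
  TensorProduct.map LinearMap.id (orbitMap g v)

@[simp] theorem actSecond_tmul (v : V) (a b : g) : actSecond v (a ⊗ₜ[ℂ] b) = a ⊗ₜ ⁅b, v⁆ := rfl

/-- The map `a ⊗ u ↦ a.w ⊗ u`. -/
def actFirst (w : V) : g ⊗[ℂ] V →ₗ[ℂ] V ⊗[ℂ] V :=
  TensorProduct.map (orbitMap g w) LinearMap.id

@[simp] theorem actFirst_tmul (w : V) (a : g) (u : V) :
    actFirst w (a ⊗ₜ[ℂ] u) = ⁅a, w⁆ ⊗ₜ u := rfl

theorem lie_actSecond (x : g) (v : V) (t : g ⊗[ℂ] g) :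
    ⁅x, actSecond v t⁆ = actSecond v ⁅x, t⁆ + actSecond ⁅x, v⁆ t := by
  induction t with
  | zero => simp
  | tmul a b =>
    simp only [actSecond_tmul, TensorProduct.LieModule.lie_tmul_right, map_add,
      leibniz_lie x b v, TensorProduct.tmul_add]
    abel
  | add a b ha hb => simp only [map_add, lie_add, ha, hb]; abel

theorem TensorProduct.comm_lie {M : Type*} [AddCommGroup M] [Module ℂ M] [LieRingModule g M]
    [LieModule ℂ g M] (x : g) (t : M ⊗[ℂ] M) :
    TensorProduct.comm ℂ M M ⁅x, t⁆ = ⁅x, TensorProduct.comm ℂ M M t⁆ := by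
  induction t with
  | zero => simp
  | tmul a b => simp [TensorProduct.LieModule.lie_tmul_right, add_comm]
  | add a b ha hb => simp only [map_add, lie_add, ha, hb]

/-- The component in `g ⊗ V` of the restriction to `V` of a cobracket on `g ⋉ V`. -/
def mixedPart (δ : InhomLie g V →ₗ[ℂ] InhomLie g V ⊗[ℂ] InhomLie g V) : V →ₗ[ℂ] g ⊗[ℂ] V :=
  TensorProduct.map (projAlg g V) (projMod g V) ∘ₗ δ ∘ₗ inclMod g V

namespace IsSemidirectLieBialgebra

variable {δ₀ : g →ₗ[ℂ] g ⊗[ℂ] g} {δ : InhomLie g V →ₗ[ℂ] InhomLie g V ⊗[ℂ] InhomLie g V}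
  (h : IsSemidirectLieBialgebra δ₀ δ)

include h

theorem apply_inclMod (v : V) :
    δ (inclMod g V v) = TensorProduct.map (inclAlg g V) (inclMod g V) (mixedPart δ v) -
      TensorProduct.comm ℂ _ _
        (TensorProduct.map (inclAlg g V) (inclMod g V) (mixedPart δ v)) := by
  change δ (inclMod g V v) = TensorProduct.map (inclAlg g V) (inclMod g V)
    (TensorProduct.map (projAlg g V) (projMod g V) (δ (inclMod g V v))) -
      TensorProduct.comm ℂ _ _ (TensorProduct.map (inclAlg g V) (inclMod g V)
        (TensorProduct.map (projAlg g V) (projMod g V) (δ (inclMod g V v))))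
  have hv := h.mapsTo v
  generalize δ (inclMod g V v) = t at hv ⊢
  induction hv using Submodule.span_induction with
  | mem t ht =>
    obtain ⟨w, x, rfl⟩ := ht
    simp
    abel
  | zero => simp
  | add a b _ _ ha hb =>
    simp only [map_add]
    nth_rewrite 1 [ha, hb]
    abel
  | smul c a _ ha =>
    simp only [map_smul]
    nth_rewrite 1 [ha]
    rw [smul_sub]

theorem comm_restrict (x : g) : TensorProduct.comm ℂ g g (δ₀ x) = -δ₀ x := by
  have h1 := congrArg (TensorProduct.map (projAlg g V) (projAlg g V))
    (h.isLieBialgebra.skew (inclAlg g V x))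
  have h2 : TensorProduct.map (projAlg g V) (projAlg g V) (δ (inclAlg g V x)) = δ₀ x := by
    rw [h.restrict, ← LinearMap.comp_apply, ← TensorProduct.map_comp]
    exact LinearMap.congr_fun TensorProduct.map_id _
  rwa [TensorProduct.map_comm, map_neg, h2] at h1

/-- The `g ⊗ V` component of the cocycle condition for the pair `(x, v)`. -/
theorem mixedPart_lie (x : g) (v : V) :
    mixedPart δ ⁅x, v⁆ = actSecond v (δ₀ x) + ⁅x, mixedPart δ v⁆ := by
  have h1 := congrArg (TensorProduct.map (projAlg g V) (projMod g V))
    (h.isLieBialgebra.cocycle (inclAlg g V x) (inclMod g V v))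
  rw [lie_inclAlg_inclMod, map_add, map_neg, h.restrict, h.apply_inclMod v] at h1
  have h2 : ∀ t : g ⊗[ℂ] g, TensorProduct.map (projAlg g V) (projMod g V)
      ⁅inclMod g V v, TensorProduct.map (inclAlg g V) (inclAlg g V) t⁆ = -actSecond v t := by
    intro t
    induction t with
    | zero => simp
    | tmul a b =>
      simp [-LieAlgebra.SemiDirectSum.lie_eq_mk, -LieAlgebra.SemiDirectSum.neg_eq_mk,
        -LieAlgebra.SemiDirectSum.zero_eq_mk, TensorProduct.LieModule.lie_tmul_right, lie_inclMod_inclAlg, TensorProduct.tmul_neg]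
    | add a b ha hb => simp only [map_add, lie_add, ha, hb, neg_add]
  have h3 : ∀ t : g ⊗[ℂ] V, TensorProduct.map (projAlg g V) (projMod g V)
      ⁅inclAlg g V x, TensorProduct.map (inclAlg g V) (inclMod g V) t -
        TensorProduct.comm ℂ _ _ (TensorProduct.map (inclAlg g V) (inclMod g V) t)⁆ =
      ⁅x, t⁆ := by
    intro t
    induction t with
    | zero => simp
    | tmul a b =>
      simp [-LieAlgebra.SemiDirectSum.lie_eq_mk, -LieAlgebra.SemiDirectSum.neg_eq_mk,
        -LieAlgebra.SemiDirectSum.zero_eq_mk, TensorProduct.LieModule.lie_tmul_right, lie_inclAlg_inclMod, lie_inclAlg_inclAlg]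
    | add a b ha hb =>
      simp only [map_add, lie_add, lie_sub, map_sub] at ha hb ⊢
      linear_combination (norm := module) ha + hb
  rw [h2, h3, neg_neg] at h1
  exact h1

/-- The `V ⊗ V` component of the cocycle condition for `[v, w] = 0`. -/
theorem actFirst_mixedPart_sub_comm (v w : V) :
    actFirst w (mixedPart δ v) - TensorProduct.comm ℂ V V (actFirst w (mixedPart δ v)) =
      actFirst v (mixedPart δ w) - TensorProduct.comm ℂ V V (actFirst v (mixedPart δ w)) := by
  have h1 := congrArg (TensorProduct.map (projMod g V) (projMod g V))
    (h.isLieBialgebra.cocycle (inclMod g V v) (inclMod g V w))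
  rw [lie_inclMod_inclMod, map_zero, map_zero, map_add, map_neg, h.apply_inclMod v,
    h.apply_inclMod w] at h1
  have h2 : ∀ (u : V) (t : g ⊗[ℂ] V), TensorProduct.map (projMod g V) (projMod g V)
      ⁅inclMod g V u, TensorProduct.map (inclAlg g V) (inclMod g V) t -
        TensorProduct.comm ℂ _ _ (TensorProduct.map (inclAlg g V) (inclMod g V) t)⁆ =
      -(actFirst u t - TensorProduct.comm ℂ V V (actFirst u t)) := by
    intro u t
    induction t with
    | zero => simp
    | tmul a b =>
      simp [-LieAlgebra.SemiDirectSum.lie_eq_mk, -LieAlgebra.SemiDirectSum.neg_eq_mk,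
        -LieAlgebra.SemiDirectSum.zero_eq_mk, TensorProduct.LieModule.lie_tmul_right, lie_inclMod_inclAlg, lie_inclMod_inclMod,
        TensorProduct.neg_tmul, TensorProduct.tmul_neg]
      abel
    | add a b ha hb =>
      simp only [map_add, lie_add, lie_sub, map_sub] at ha hb ⊢
      linear_combination (norm := module) ha + hb
  rw [h2, h2, neg_neg] at h1
  rw [← sub_eq_zero]
  rw [← sub_eq_add_neg] at h1
  exact h1.symm

omit h in
theorem dualBracket_apply (ξ η : Module.Dual ℂ (InhomLie g V)) (a : InhomLie g V) :
    dualBracket δ ξ η a = TensorProduct.dualDistrib ℂ _ _ (ξ ⊗ₜ[ℂ] η) (δ a) := rfl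

theorem dualBracket_skew (ξ η : Module.Dual ℂ (InhomLie g V)) :
    dualBracket δ ξ η = -dualBracket δ η ξ := by
  ext a
  rw [LinearMap.neg_apply, dualBracket_apply, dualBracket_apply, ← dualDistrib_comm,
    h.isLieBialgebra.skew, map_neg]

theorem dualBracket_alg_alg {ξ η ν : Module.Dual ℂ g}
    (hν : ∀ x, ν x = TensorProduct.dualDistrib ℂ g g (ξ ⊗ₜ[ℂ] η) (δ₀ x)) :
    dualBracket δ (ξ ∘ₗ projAlg g V) (η ∘ₗ projAlg g V) = ν ∘ₗ projAlg g V := by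
  ext a
  rw [dualBracket_apply, LinearMap.comp_apply, hν, ← inclMod_projMod_add_inclAlg_projAlg a]
  generalize projMod g V a = v
  generalize projAlg g V a = x
  rw [map_add, map_add, map_add, projAlg_inclAlg, projAlg_inclMod, zero_add, h.restrict,
    h.apply_inclMod]
  have h1 : ∀ t : g ⊗[ℂ] V, TensorProduct.dualDistrib ℂ _ _
      ((ξ ∘ₗ projAlg g V) ⊗ₜ[ℂ] (η ∘ₗ projAlg g V))
      (TensorProduct.map (inclAlg g V) (inclMod g V) t -
        TensorProduct.comm ℂ _ _ (TensorProduct.map (inclAlg g V) (inclMod g V) t)) = 0 := by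
    intro t
    induction t with
    | zero => simp
    | tmul a b => simp
    | add a b ha hb =>
      simp only [map_add, map_sub] at ha hb ⊢
      linear_combination ha + hb
  have h2 : ∀ t : g ⊗[ℂ] g, TensorProduct.dualDistrib ℂ _ _
      ((ξ ∘ₗ projAlg g V) ⊗ₜ[ℂ] (η ∘ₗ projAlg g V))
      (TensorProduct.map (inclAlg g V) (inclAlg g V) t) =
        TensorProduct.dualDistrib ℂ g g (ξ ⊗ₜ[ℂ] η) t := by
    intro t
    induction t with
    | zero => simp
    | tmul a b => simp
    | add a b ha hb => simp only [map_add, ha, hb]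
  rw [h1, h2, zero_add]

/-- Bracketing with `ξ` acts on `V*` by the transpose of an operator on `V`; transposition is what
makes contraction an anti-homomorphism. -/
theorem dualBracket_alg_mod {s : g ⊗[ℂ] g} {ξ : Module.Dual ℂ g}
    (hs : ∀ v, contractFirst V ξ (mixedPart δ v) = ⁅contractFirst g ξ s, v⁆)
    (ζ : Module.Dual ℂ V) :
    dualBracket δ (ξ ∘ₗ projAlg g V) (ζ ∘ₗ projMod g V) =
      (ζ ∘ₗ LieModule.toEnd ℂ g V (contractFirst g ξ s)) ∘ₗ projMod g V := by
  ext a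
  rw [dualBracket_apply, LinearMap.comp_apply, LinearMap.comp_apply,
    LieModule.toEnd_apply_apply, ← hs, ← inclMod_projMod_add_inclAlg_projAlg a]
  generalize projMod g V a = v
  generalize projAlg g V a = x
  rw [map_add, map_add, map_add, projMod_inclAlg, projMod_inclMod, add_zero, h.restrict,
    h.apply_inclMod, ← dualDistrib_eq_contractFirst]
  have h1 : ∀ t : g ⊗[ℂ] V, TensorProduct.dualDistrib ℂ _ _
      ((ξ ∘ₗ projAlg g V) ⊗ₜ[ℂ] (ζ ∘ₗ projMod g V))
      (TensorProduct.map (inclAlg g V) (inclMod g V) t -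
        TensorProduct.comm ℂ _ _ (TensorProduct.map (inclAlg g V) (inclMod g V) t)) =
        TensorProduct.dualDistrib ℂ g V (ξ ⊗ₜ[ℂ] ζ) t := by
    intro t
    induction t with
    | zero => simp
    | tmul a b => simp
    | add a b ha hb =>
      simp only [map_add, map_sub] at ha hb ⊢
      linear_combination ha + hb
  have h2 : ∀ t : g ⊗[ℂ] g, TensorProduct.dualDistrib ℂ _ _
      ((ξ ∘ₗ projAlg g V) ⊗ₜ[ℂ] (ζ ∘ₗ projMod g V))
      (TensorProduct.map (inclAlg g V) (inclAlg g V) t) = 0 := by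
    intro t
    induction t with
    | zero => simp
    | tmul a b => simp
    | add a b ha hb => simp only [map_add, ha, hb, add_zero]
  rw [h1, h2, add_zero]

/-- If the mixed part of the cobracket is given by `s`, then contraction of `s` is an
anti-homomorphism from the dual Lie algebra of `g` to the operators on `V`. -/
theorem lie_contractFirst_lie {s : g ⊗[ℂ] g}
    (hs : ∀ ξ v, contractFirst V ξ (mixedPart δ v) = ⁅contractFirst g ξ s, v⁆)
    {ξ η ν : Module.Dual ℂ g}
    (hν : ∀ x, ν x = TensorProduct.dualDistrib ℂ g g (ξ ⊗ₜ[ℂ] η) (δ₀ x)) (v : V) :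
    ⁅⁅contractFirst g η s, contractFirst g ξ s⁆, v⁆ = ⁅contractFirst g ν s, v⁆ := by
  rw [← sub_eq_zero, ← Module.forall_dual_apply_eq_zero_iff ℂ]
  intro ζ
  have h1 := h.isLieBialgebra.dual_jacobi (ξ ∘ₗ projAlg g V) (η ∘ₗ projAlg g V) (ζ ∘ₗ projMod g V)
  rw [h.dualBracket_skew (ζ ∘ₗ projMod g V) (ξ ∘ₗ projAlg g V), h.dualBracket_alg_alg hν,
    h.dualBracket_skew (ζ ∘ₗ projMod g V), h.dualBracket_alg_mod (hs ξ), h.dualBracket_alg_mod (hs η),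
    h.dualBracket_alg_mod (hs ν), ← LinearMap.neg_comp, h.dualBracket_alg_mod (hs η),
    h.dualBracket_alg_mod (hs ξ)] at h1
  have h2 := LinearMap.congr_fun h1 (inclMod g V v)
  simp only [LinearMap.add_apply, LinearMap.neg_apply, LinearMap.comp_apply, projMod_inclMod,
    LieModule.toEnd_apply_apply, LinearMap.zero_apply] at h2
  rw [map_sub, lie_lie, map_sub]
  linear_combination h2

theorem mixedPart_sub_actSecond_lie {s : g ⊗[ℂ] g} (hδ₀ : ∀ x, δ₀ x = -⁅x, s⁆) (x : g) (v : V) :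
    mixedPart δ ⁅x, v⁆ - actSecond ⁅x, v⁆ s = ⁅x, mixedPart δ v - actSecond v s⁆ := by
  rw [h.mixedPart_lie, hδ₀, map_neg, lie_sub, lie_actSecond]
  abel

omit h in
theorem comm_actFirst_actSecond (v w : V) (s : g ⊗[ℂ] g) :
    TensorProduct.comm ℂ V V (actFirst w (actSecond v s)) =
      actFirst v (actSecond w (TensorProduct.comm ℂ g g s)) := by
  induction s with
  | zero => simp
  | tmul a b => simp
  | add a b ha hb => simp only [map_add, ha, hb]

/-- For skew `s`, flipping the `s`-term exchanges `v` and `w` up to sign. Its contribution to each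
side is thus the same symmetric expression, and the condition passes to the difference. -/
theorem actFirst_sub_comm {s : g ⊗[ℂ] g} (hs : TensorProduct.comm ℂ g g s = -s) (v w : V) :
    actFirst w (mixedPart δ v - actSecond v s) -
        TensorProduct.comm ℂ V V (actFirst w (mixedPart δ v - actSecond v s)) =
      actFirst v (mixedPart δ w - actSecond w s) -
        TensorProduct.comm ℂ V V (actFirst v (mixedPart δ w - actSecond w s)) := by
  have h1 := h.actFirst_mixedPart_sub_comm v w
  simp only [map_sub, comm_actFirst_actSecond, hs, map_neg]
  linear_combination (norm := module) h1

/-- A skew-symmetric cobracket `x ↦ -[x, r]` only depends on the skew-symmetric part of `r`. -/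
theorem eq_neg_lie_skewPart {r : g ⊗[ℂ] g} (hr : ∀ x, δ₀ x = -⁅x, r⁆) (x : g) :
    δ₀ x = -⁅x, (1 / 2 : ℂ) • (r - TensorProduct.comm ℂ g g r)⁆ := by
  have h1 := h.comm_restrict x
  rw [hr, map_neg, TensorProduct.comm_lie] at h1
  rw [hr, lie_smul, lie_sub]
  linear_combination (norm := module) (1 / 2 : ℂ) • h1

end IsSemidirectLieBialgebra

end SemidirectBialgebra

/-! ### The symplectic form and `sp(2n)` as the symmetric square of `V` -/

section SymplecticNatural

open Matrix

variable {n : ℕ}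

/-- The coordinates of a vector of the natural module. -/
def coords : NaturalModule n ≃ₗ[ℂ] (Fin n ⊕ Fin n → ℂ) :=
  LinearEquiv.refl ℂ (Fin n ⊕ Fin n → ℂ)

/-- The symplectic form on the natural module. -/
def sympForm (n : ℕ) : LinearMap.BilinForm ℂ (NaturalModule n) :=
  (Matrix.toLinearMap₂' ℂ (Matrix.J (Fin n) ℂ)).compl₁₂ coords.toLinearMap coords.toLinearMap

theorem sympForm_apply (u v : NaturalModule n) :
    sympForm n u v = coords u ⬝ᵥ (Matrix.J (Fin n) ℂ *ᵥ coords v) :=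
  Matrix.toLinearMap₂'_apply' _ _ _

theorem sympForm_swap (u v : NaturalModule n) : sympForm n u v = -sympForm n v u := by
  rw [sympForm_apply, sympForm_apply, Matrix.dotProduct_mulVec, ← Matrix.mulVec_transpose,
    Matrix.J_transpose, Matrix.neg_mulVec, neg_dotProduct, dotProduct_comm]

theorem sympForm_self (u : NaturalModule n) : sympForm n u u = 0 :=
  self_eq_neg.mp (sympForm_swap u u)

theorem eq_zero_of_sympForm {v : NaturalModule n} (h : ∀ u, sympForm n u v = 0) : v = 0 := by
  have h1 : Matrix.J (Fin n) ℂ *ᵥ coords v = 0 := by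
    refine dotProduct_eq_zero_iff.mp fun u => ?_
    rw [dotProduct_comm, ← coords.apply_symm_apply u, ← sympForm_apply]
    exact h _
  have h2 := congrArg (fun w => Matrix.J (Fin n) ℂ *ᵥ w) h1
  simp only [Matrix.mulVec_mulVec, Matrix.J_squared, Matrix.neg_mulVec, Matrix.one_mulVec,
    Matrix.mulVec_zero, neg_eq_zero] at h2
  exact coords.map_eq_zero_iff.mp h2

theorem transpose_mul_J (A : SpLie n) :
    (A.1)ᵀ * Matrix.J (Fin n) ℂ = -(Matrix.J (Fin n) ℂ * A.1) := by
  have h := (mem_skewAdjointMatricesSubmodule (Matrix.J (Fin n) ℂ) A.1).mp A.2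
  rw [Matrix.IsSkewAdjoint, Matrix.IsAdjointPair] at h
  rw [h, mul_neg]

theorem coords_lie (A : SpLie n) (v : NaturalModule n) : coords ⁅A, v⁆ = A.1 *ᵥ coords v := rfl

theorem sympForm_lie (A : SpLie n) (u v : NaturalModule n) :
    sympForm n u ⁅A, v⁆ = -sympForm n ⁅A, u⁆ v := by
  rw [sympForm_apply, sympForm_apply, coords_lie, coords_lie, Matrix.mulVec_mulVec,
    ← neg_neg (Matrix.J (Fin n) ℂ * A.1), ← transpose_mul_J, Matrix.neg_mulVec, dotProduct_neg,
    ← Matrix.mulVec_mulVec, Matrix.dotProduct_mulVec, ← Matrix.mulVec_transpose,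
    Matrix.transpose_transpose]

theorem natural_faithful {A B : SpLie n} (h : ∀ v : NaturalModule n, ⁅A, v⁆ = ⁅B, v⁆) : A = B :=
  Subtype.ext (Matrix.ext_of_mulVec_single fun i => h (coords.symm (Pi.single i 1)))

/-- The element `w ↦ ω(v, w) u + ω(u, w) v` of the symplectic Lie algebra. -/
def symPair (u v : NaturalModule n) : SpLie n :=
  ⟨(vecMulVec (coords u) (coords v) + vecMulVec (coords v) (coords u)) * Matrix.J (Fin n) ℂ, by
    refine (mem_skewAdjointMatricesSubmodule (Matrix.J (Fin n) ℂ) _).mpr ?_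
    rw [Matrix.IsSkewAdjoint, Matrix.IsAdjointPair, Matrix.transpose_mul, Matrix.transpose_add,
      Matrix.transpose_vecMulVec, Matrix.transpose_vecMulVec, Matrix.J_transpose]
    simp only [Matrix.neg_mul, Matrix.mul_neg, Matrix.mul_assoc]
    rw [add_comm]⟩

theorem symPair_val (u v : NaturalModule n) : (symPair u v).1 =
    (vecMulVec (coords u) (coords v) + vecMulVec (coords v) (coords u)) * Matrix.J (Fin n) ℂ := rfl

theorem symPair_lie (u v w : NaturalModule n) :
    ⁅symPair u v, w⁆ = sympForm n v w • u + sympForm n u w • v := by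
  apply coords.injective
  rw [coords_lie, symPair_val, ← Matrix.mulVec_mulVec, Matrix.add_mulVec, sympForm_apply,
    sympForm_apply, Matrix.vecMulVec_mulVec, Matrix.vecMulVec_mulVec, op_smul_eq_smul,
    op_smul_eq_smul, map_add, map_smul, map_smul]

theorem lie_symPair (A : SpLie n) (u v : NaturalModule n) :
    ⁅A, symPair u v⁆ = symPair ⁅A, u⁆ v + symPair u ⁅A, v⁆ := by
  refine natural_faithful fun w => ?_
  rw [lie_lie, add_lie, symPair_lie, symPair_lie, symPair_lie, symPair_lie, sympForm_lie,
    sympForm_lie, lie_add, lie_smul, lie_smul]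
  module

theorem mem_span_symPair (A : SpLie n) :
    A ∈ Submodule.span ℂ {B | ∃ u v : NaturalModule n, B = symPair u v} := by
  -- Since `J⁻¹ = -J`, this is `A J⁻¹`, which is symmetric exactly because `A` is symplectic.
  set S : Matrix (Fin n ⊕ Fin n) (Fin n ⊕ Fin n) ℂ := -(A.1 * Matrix.J (Fin n) ℂ) with hS
  have hJ := Matrix.J_squared (Fin n) ℂ
  have hA : A.1 = S * Matrix.J (Fin n) ℂ := by
    rw [hS, Matrix.neg_mul, Matrix.mul_assoc, hJ, mul_neg, mul_one, neg_neg]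
  have hSt : Sᵀ = S := by
    have h1 : (A.1)ᵀ = Matrix.J (Fin n) ℂ * A.1 * Matrix.J (Fin n) ℂ := by
      rw [← neg_neg (Matrix.J (Fin n) ℂ * A.1), ← transpose_mul_J, Matrix.neg_mul,
        Matrix.mul_assoc, hJ, mul_neg, mul_one, neg_neg]
    rw [hS, Matrix.transpose_neg, Matrix.transpose_mul, h1, Matrix.J_transpose, Matrix.neg_mul,
      ← Matrix.mul_assoc, ← Matrix.mul_assoc, hJ, Matrix.neg_mul, Matrix.neg_mul, one_mul,
      neg_neg]
  have hsum : A = (1 / 2 : ℂ) • ∑ i, ∑ j, S i j •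
      symPair (coords.symm (Pi.single i 1)) (coords.symm (Pi.single j 1)) := by
    apply Subtype.ext
    rw [hA]
    simp only [SetLike.val_smul, AddSubmonoidClass.coe_finsetSum,
      symPair_val, LinearEquiv.apply_symm_apply]
    simp only [← Matrix.smul_mul, ← Finset.sum_mul]
    congr 1
    have h1 : ∑ i, ∑ j, S i j • vecMulVec (Pi.single i (1 : ℂ)) (Pi.single j (1 : ℂ)) = S := by
      conv_rhs => rw [Matrix.matrix_eq_sum_single S]
      simp [← Matrix.single_eq_single_vecMulVec_single]
    have h2 : ∑ i, ∑ j, S i j • vecMulVec (Pi.single j (1 : ℂ)) (Pi.single i (1 : ℂ)) = S := by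
      have h3 := congrArg Matrix.transpose h1
      simpa only [Matrix.transpose_sum, Matrix.transpose_smul, Matrix.transpose_vecMulVec,
        hSt] using h3
    simp only [smul_add, Finset.sum_add_distrib]
    rw [h1, h2]
    module
  rw [hsum]
  exact Submodule.smul_mem _ _ (Submodule.sum_mem _ fun i _ => Submodule.sum_mem _ fun j _ =>
    Submodule.smul_mem _ _ (Submodule.subset_span ⟨_, _, rfl⟩))

variable (n) in
/-- The trace form of the natural module. -/
def traceForm : LinearMap.BilinForm ℂ (SpLie n) :=
  LinearMap.mk₂ ℂ (fun A B => Matrix.trace (A.1 * B.1))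
    (fun A B C => by simp [add_mul]) (fun c A B => by simp)
    (fun A B C => by simp [mul_add]) (fun c A B => by simp)

theorem traceForm_apply (A B : SpLie n) : traceForm n A B = Matrix.trace (A.1 * B.1) := rfl

theorem traceForm_lie (A B C : SpLie n) : traceForm n A ⁅B, C⁆ = -traceForm n ⁅B, A⁆ C := by
  rw [traceForm_apply, traceForm_apply]
  change Matrix.trace (A.1 * (B.1 * C.1 - C.1 * B.1)) =
    -Matrix.trace ((B.1 * A.1 - A.1 * B.1) * C.1)
  rw [mul_sub, sub_mul, Matrix.trace_sub, Matrix.trace_sub, ← Matrix.mul_assoc, ← Matrix.mul_assoc,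
    Matrix.trace_mul_comm (A.1 * C.1), ← Matrix.mul_assoc]
  ring

theorem traceForm_symPair (u v : NaturalModule n) (A : SpLie n) :
    traceForm n (symPair u v) A = 2 * sympForm n u ⁅A, v⁆ := by
  have h : ∀ u v : NaturalModule n,
      Matrix.trace (vecMulVec (coords u) (coords v) * (Matrix.J (Fin n) ℂ * A.1)) = sympForm n v ⁅A, u⁆ := by
    intro u v
    rw [sympForm_apply, coords_lie, Matrix.mulVec_mulVec, Matrix.trace_mul_comm,
      Matrix.mul_vecMulVec, Matrix.trace_vecMulVec, dotProduct_comm]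
  rw [traceForm_apply, symPair_val, Matrix.mul_assoc, add_mul, Matrix.trace_add, h, h, sympForm_lie, sympForm_swap, neg_neg]
  ring

theorem exists_eq_traceForm (ξ : Module.Dual ℂ (SpLie n)) : ∃ A, traceForm n A = ξ := by
  have hinj : Function.Injective (traceForm n) := by
    rw [injective_iff_map_eq_zero]
    intro A hA
    refine natural_faithful fun v => ?_
    rw [zero_lie]
    refine eq_zero_of_sympForm fun u => ?_
    have h1 : traceForm n (symPair u v) A = traceForm n A (symPair u v) :=
      Matrix.trace_mul_comm (symPair u v).1 A.1
    rw [hA, traceForm_symPair, LinearMap.zero_apply] at h1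
    exact (mul_eq_zero.mp h1).resolve_left two_ne_zero
  exact (LinearMap.injective_iff_surjective_of_finrank_eq_finrank
    (Subspace.dual_finrank_eq (K := ℂ) (V := SpLie n)).symm).mp hinj ξ

theorem exists_sympForm_eq_one (hn : 1 ≤ n) : ∃ b e : NaturalModule n, sympForm n b e = 1 := by
  let i : Fin n := ⟨0, hn⟩
  refine ⟨coords.symm (Pi.single (Sum.inr i) 1), coords.symm (Pi.single (Sum.inl i) 1), ?_⟩
  rw [sympForm_apply, LinearEquiv.apply_symm_apply, LinearEquiv.apply_symm_apply]
  simp [Matrix.J]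

end SymplecticNatural

/-! ### Equivariant maps `g → End V` and `V → g ⊗ V` -/

section SymplecticRigidity

variable {n : ℕ}

theorem exists_lie_eq {b e : NaturalModule n} (hbe : sympForm n b e = 1) (w : NaturalModule n) :
    ∃ A : SpLie n, ⁅A, e⁆ = w := by
  refine ⟨symPair w b - (1 / 2 * sympForm n w e) • symPair b b, ?_⟩
  rw [sub_lie, smul_lie, symPair_lie, symPair_lie, hbe]
  module

/-- An operator of weight two for the semisimple element `symPair e b` is a multiple of the
highest root vector `symPair e e`. -/
theorem exists_eq_smul_of_weight_two {b e : NaturalModule n} (hbe : sympForm n b e = 1)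
    (f : Module.End ℂ (NaturalModule n))
    (hf : ∀ v : NaturalModule n, ⁅symPair e b, f v⁆ = f ⁅symPair e b, v⁆ + (2 : ℂ) • f v) :
    ∃ c : ℂ, ∀ v : NaturalModule n, f v = c • ⁅symPair e e, v⁆ := by
  have heb : sympForm n e b = -1 := by rw [sympForm_swap, hbe]
  have hee := sympForm_self e
  have hbb := sympForm_self b
  -- The weights of `symPair e b` on `V` are `1` at `e`, `-1` at `b` and `0` on their orthogonal
  -- complement. An `f` raising weights by two can therefore only send `b` to a multiple of `e`.
  have hcube : ∀ v : NaturalModule n, ⁅symPair e b, ⁅symPair e b, ⁅symPair e b, v⁆⁆⁆ = ⁅symPair e b, v⁆ := by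
    intro v
    simp only [symPair_lie, map_add, map_smul, hbe, heb, hee, hbb, smul_eq_mul]
    module
  have hzero : ∀ (m : ℂ), m ^ 3 ≠ m → ∀ v : NaturalModule n, ⁅symPair e b, v⁆ = m • v → v = 0 := by
    intro m hm v hv
    have h1 := hcube v
    rw [hv, lie_smul, lie_smul, hv, lie_smul, hv] at h1
    have h2 : (m ^ 3 - m) • v = 0 := by
      linear_combination (norm := module) h1
    exact (smul_eq_zero.mp h2).resolve_left (sub_ne_zero.mpr hm)
  have he : f e = 0 := by
    refine hzero 3 (by norm_num) _ ?_
    rw [hf, symPair_lie, hbe, hee, zero_smul, add_zero, one_smul]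
    module
  have hker : ∀ v : NaturalModule n, ⁅symPair e b, v⁆ = 0 → f v = 0 := by
    intro v hv
    refine hzero 2 (by norm_num) _ ?_
    rw [hf, hv, map_zero, zero_add]
  obtain ⟨c, hc⟩ : ∃ c : ℂ, f b = c • e := by
    have h1 : ⁅symPair e b, f b⁆ = f b := by
      rw [hf, symPair_lie, heb, hbb]
      simp only [zero_smul, zero_add, map_smul]
      module
    have h2 := congrArg (sympForm n e) h1
    rw [symPair_lie, map_add, map_smul, map_smul, hee, heb, smul_eq_mul, smul_eq_mul] at h2
    have h3 : sympForm n e (f b) = 0 := by linear_combination (-1 / 2 : ℂ) * h2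
    rw [symPair_lie, h3, zero_smul, add_zero] at h1
    exact ⟨_, h1.symm⟩
  refine ⟨-c / 2, fun v => ?_⟩
  -- This is the projection of `v` to the zero weight space.
  have h1 := hker (v - sympForm n b v • e + sympForm n e v • b) (by
    rw [lie_add, lie_sub, lie_smul, lie_smul, symPair_lie, symPair_lie, symPair_lie, hbe, hee, heb,
      hbb]
    module)
  rw [map_add, map_sub, map_smul, map_smul, he, hc] at h1
  rw [symPair_lie]
  linear_combination (norm := module) h1

/-- The only equivariant maps from the symplectic Lie algebra to the operators on its natural
module are the multiples of the action. -/
theorem exists_eq_smul_lie {b e : NaturalModule n} (hbe : sympForm n b e = 1)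
    (f : SpLie n →ₗ[ℂ] Module.End ℂ (NaturalModule n))
    (hf : ∀ (A B : SpLie n) (v : NaturalModule n), f ⁅A, B⁆ v = ⁅A, f B v⁆ - f B ⁅A, v⁆) :
    ∃ c : ℂ, ∀ (A : SpLie n) (v : NaturalModule n), f A v = c • ⁅A, v⁆ := by
  have hweight : ⁅symPair e b, symPair e e⁆ = (2 : ℂ) • symPair e e := by
    have h1 : ⁅symPair e b, e⁆ = e := by
      rw [symPair_lie, hbe, sympForm_self]
      module
    rw [lie_symPair, h1]
    module
  obtain ⟨c, hc⟩ := exists_eq_smul_of_weight_two hbe (f (symPair e e)) (fun v => by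
    have h1 := hf (symPair e b) (symPair e e) v
    rw [hweight, map_smul, LinearMap.smul_apply] at h1
    rw [h1]
    abel)
  refine ⟨c, ?_⟩
  have hstep : ∀ A B : SpLie n, (∀ v : NaturalModule n, f B v = c • ⁅B, v⁆) → ∀ v : NaturalModule n, f ⁅A, B⁆ v = c • ⁅⁅A, B⁆, v⁆ := by
    intro A B hB v
    rw [hf, hB, hB, lie_lie, lie_smul, smul_sub]
  have hadd : ∀ u v w : NaturalModule n, symPair (u + v) w = symPair u w + symPair v w := by
    intro u v w
    refine natural_faithful fun x => ?_
    rw [add_lie, symPair_lie, symPair_lie, symPair_lie, map_add, LinearMap.add_apply]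
    module
  have hcomm : ∀ u v : NaturalModule n, symPair u v = symPair v u := fun u v =>
    natural_faithful fun x => by rw [symPair_lie, symPair_lie, add_comm]
  -- Bracketing `symPair e e` with `A` gives `2 symPair (A.e) e`, and `A.e` is arbitrary; a second
  -- bracket then reaches every `symPair w u`.
  have h1 : ∀ w v, f (symPair w e) v = c • ⁅symPair w e, v⁆ := by
    intro w v
    obtain ⟨A, rfl⟩ := exists_lie_eq hbe w
    have h2 := hstep A (symPair e e) hc v
    rw [lie_symPair, hcomm e ⁅A, e⁆, map_add, add_lie, LinearMap.add_apply] at h2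
    linear_combination (norm := module) (1 / 2 : ℂ) • h2
  have h2 : ∀ w u v, f (symPair w u) v = c • ⁅symPair w u, v⁆ := by
    intro w u v
    obtain ⟨A, rfl⟩ := exists_lie_eq hbe u
    have h3 := hstep A (symPair w e) (h1 w) v
    rw [lie_symPair, map_add, add_lie, LinearMap.add_apply, h1] at h3
    linear_combination (norm := module) h3
  intro A v
  induction mem_span_symPair A using Submodule.span_induction with
  | mem B hB =>
    obtain ⟨w, u, rfl⟩ := hB
    exact h2 w u v
  | zero => simp
  | add B C _ _ hB hC => rw [map_add, LinearMap.add_apply, hB, hC, add_lie, smul_add]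
  | smul a B _ hB => rw [map_smul, LinearMap.smul_apply, hB, smul_lie, smul_comm]

theorem contractFirst_lie (A B : SpLie n) (t : SpLie n ⊗[ℂ] NaturalModule n) :
    contractFirst (NaturalModule n) (traceForm n B) ⁅A, t⁆ =
      ⁅A, contractFirst (NaturalModule n) (traceForm n B) t⁆ -
        contractFirst (NaturalModule n) (traceForm n ⁅A, B⁆) t := by
  induction t with
  | zero => simp
  | tmul x v =>
    rw [TensorProduct.LieModule.lie_tmul_right, map_add, contractFirst_tmul, contractFirst_tmul,
      contractFirst_tmul, contractFirst_tmul, traceForm_lie, lie_smul]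
    module
  | add a b ha hb =>
    rw [lie_add, map_add, ha, hb, map_add, map_add, lie_add]
    abel

theorem dualDistrib_actFirst (u w : NaturalModule n) (η : Module.Dual ℂ (NaturalModule n))
    (t : SpLie n ⊗[ℂ] NaturalModule n) :
    TensorProduct.dualDistrib ℂ _ _ (sympForm n u ⊗ₜ[ℂ] η) (actFirst w t) =
      1 / 2 * η (contractFirst (NaturalModule n) (traceForm n (symPair u w)) t) := by
  induction t with
  | zero => simp
  | tmul x v =>
    rw [actFirst_tmul, TensorProduct.dualDistrib_apply, contractFirst_tmul, traceForm_symPair,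
      map_smul, smul_eq_mul]
    ring
  | add a b ha hb => simp only [map_add, ha, hb, mul_add]

/-- An equivariant map `F : V → g ⊗ V` vanishes if `F - F²¹ : V → (g ⊗ V) ⊕ (V ⊗ g)` satisfies the
cocycle condition `v.F(w) = w.F(v)` on the abelian ideal `V`. -/
theorem contractFirst_eq_zero (hn : 1 ≤ n)
    (F : NaturalModule n →ₗ[ℂ] SpLie n ⊗[ℂ] NaturalModule n)
    (hF : ∀ (A : SpLie n) v, F ⁅A, v⁆ = ⁅A, F v⁆)
    (hsymm : ∀ v w, actFirst w (F v) - TensorProduct.comm ℂ _ _ (actFirst w (F v)) =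
      actFirst v (F w) - TensorProduct.comm ℂ _ _ (actFirst v (F w)))
    (ξ : Module.Dual ℂ (SpLie n)) (v : NaturalModule n) :
    contractFirst (NaturalModule n) ξ (F v) = 0 := by
  obtain ⟨b, e, hbe⟩ := exists_sympForm_eq_one hn
  let f : SpLie n →ₗ[ℂ] Module.End ℂ (NaturalModule n) :=
    LinearMap.mk₂ ℂ (fun A v => contractFirst (NaturalModule n) (traceForm n A) (F v))
      (fun A B v => by simp [contractFirst, TensorProduct.map_add_left])
      (fun c A v => by simp [contractFirst, TensorProduct.map_smul_left])
      (fun A v w => by rw [map_add, map_add]) (fun c A v => by rw [map_smul, map_smul])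
  obtain ⟨c, hc⟩ := exists_eq_smul_lie hbe f fun A B v => by
    change contractFirst _ _ (F v) = ⁅A, contractFirst _ _ (F v)⁆ - contractFirst _ _ (F ⁅A, v⁆)
    rw [hF, contractFirst_lie]
    abel
  have hc' : ∀ (A : SpLie n) (v : NaturalModule n), contractFirst (NaturalModule n) (traceForm n A) (F v) = c • ⁅A, v⁆ := hc
  have heb : sympForm n e b = -1 := by rw [sympForm_swap, hbe]
  have hee := sympForm_self e
  have hbb := sympForm_self b
  -- In this matrix coefficient the two sides are `3c/2` and `-3c/2`.
  have h1 := congrArg (TensorProduct.dualDistrib ℂ _ _ (sympForm n e ⊗ₜ[ℂ] sympForm n b))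
    (hsymm e b)
  rw [map_sub, map_sub, dualDistrib_comm, dualDistrib_comm] at h1
  simp only [dualDistrib_actFirst, hc', symPair_lie, map_add, map_smul, hbe, heb, hee, hbb,
    smul_eq_mul] at h1
  have hc0 : c = 0 := by linear_combination (1 / 3 : ℂ) * h1
  obtain ⟨A, rfl⟩ := exists_eq_traceForm ξ
  rw [hc', hc0, zero_smul]

end SymplecticRigidity

/-! ### Conclusion: the mixed part is given by `s` -/

theorem contractFirst_actSecond {g V : Type*} [LieRing g] [LieAlgebra ℂ g]
    [AddCommGroup V] [Module ℂ V] [LieRingModule g V] [LieModule ℂ g V] (ξ : Module.Dual ℂ g)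
    (v : V) (s : g ⊗[ℂ] g) :
    contractFirst V ξ (actSecond v s) = ⁅contractFirst g ξ s, v⁆ := by
  induction s with
  | zero => simp
  | tmul a b => simp
  | add a b ha hb => simp only [map_add, ha, hb, add_lie]

end

theorem mainTheorem9 (n : ℕ) (hn : 1 ≤ n)
    (δ₀ : SpLie n →ₗ[ℂ] SpLie n ⊗[ℂ] SpLie n) (hδ₀ : IsBelavinDrinfeld δ₀) :
    ¬ ∃ δ : InhomLie (SpLie n) (NaturalModule n) →ₗ[ℂ]
        InhomLie (SpLie n) (NaturalModule n) ⊗[ℂ] InhomLie (SpLie n) (NaturalModule n),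
      IsSemidirectLieBialgebra δ₀ δ := by
  rintro ⟨δ, h⟩
  obtain ⟨H, hH, D, hD⟩ := hδ₀
  obtain ⟨b, e, hbe⟩ := exists_sympForm_eq_one hn
  -- The pair `symPair e b`, `symPair e e` satisfies `[x, y] = 2y` with `y ≠ 0`.
  have hne : D.simple.Nonempty := by
    have hlie : ⁅symPair e b, e⁆ = e := by
      rw [symPair_lie, hbe, sympForm_self]
      module
    refine D.simple_nonempty (x := symPair e b) (y := symPair e e) (fun h0 => ?_) ?_
    · have h1 := congrArg (sympForm n b) (symPair_lie e e b)
      rw [h0, zero_lie, map_zero, sympForm_swap e b, map_add, map_smul, hbe] at h1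
      norm_num at h1
    · rw [lie_symPair, hlie]
      module
  have hs := h.eq_neg_lie_skewPart hD
  have hskew : TensorProduct.comm ℂ _ _ ((1 / 2 : ℂ) • D.skewMatrix) =
      -((1 / 2 : ℂ) • D.skewMatrix) := by
    rw [map_smul, D.comm_skewMatrix, smul_neg]
  change ∀ x, δ₀ x = -⁅x, (1 / 2 : ℂ) • D.skewMatrix⁆ at hs
  refine D.not_antihomomorphism hne ?_
  generalize (1 / 2 : ℂ) • D.skewMatrix = s at hs hskew ⊢
  -- The difference of two solutions of the same inhomogeneous cocycle equation, hence equivariant.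
  let F : NaturalModule n →ₗ[ℂ] SpLie n ⊗[ℂ] NaturalModule n :=
    { toFun v := mixedPart δ v - actSecond v s
      map_add' v w := by
        simp only [actSecond, map_add, orbitMap_add, TensorProduct.map_add_right,
          LinearMap.add_apply]
        abel
      map_smul' c v := by
        simp only [actSecond, map_smul, orbitMap_smul, TensorProduct.map_smul_right,
          LinearMap.smul_apply, smul_sub, RingHom.id_apply] }
  have hF := contractFirst_eq_zero hn F (h.mixedPart_sub_actSecond_lie hs)
    (h.actFirst_sub_comm hskew)
  have hmixed : ∀ ξ v, contractFirst (NaturalModule n) ξ (mixedPart δ v) =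
      ⁅contractFirst (SpLie n) ξ s, v⁆ := by
    intro ξ v
    have h1 : contractFirst (NaturalModule n) ξ (mixedPart δ v - actSecond v s) = 0 := hF ξ v
    rwa [map_sub, sub_eq_zero, contractFirst_actSecond] at h1
  intro ξ η ν hν
  refine natural_faithful fun v => h.lie_contractFirst_lie hmixed (fun x => ?_) v
  rw [hν, hs, map_neg]
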